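/- Let $p$ be a prime, $k$ a perfect field of characteristic $p$, $d\ge 1$, $A=k[t_1,\dots,t_d]$, and for $n\ge 1$ let $W_n$ denote $p$-typical Witt vectors of length $n$ and $A_n=W_n(k)[t_1,\dots,t_d]$. Let $\tilde w_{n-1}\colon W_n(A)\to A_n$ be the map $(f_1,\dots,f_n)\mapsto \sum_{i=1}^{n}p^{i-1}\tilde f_i^{\,p^{n-i}}$, where $\tilde f_i\in A_n$ is any lift of $f_i\in A$ (the value does not depend on the lifts). For $1\le j\le d$ and $r\ge 0$ let $\partial_{j,n}^{[r]}=\frac1{r!}\left(\frac{\partial}{\partial t_j}\right)^r\colon A_n\to A_n$ be the $W_n(k)$-linear operator $t^{e}\mapsto\binom{e_j}{r}t_j^{-r}t^{e}$ (which is $0$ if $e_j<r$). There is a unique $W_n(k)$-linear differential operator (in the sense of Grothendieck) on $W_n(A)$, still denoted $\partial_{j,n}^{[r]}\colon W_n(A)\to W_n(A)$, with $\tilde w_{n-1}\circ\partial_{j,n}^{[r]}=\partial_{j,n}^{[r]}\circ\tilde w_{n-1}$, and it has order at most $r$. Let $R\colon W_{n+1}(A)\to W_n(A)$ be the restriction $(a_1,\dots,a_{n+1})\mapsto(a_1,\dots,a_n)$,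 $V\colon W_n(A)\to W_{n+1}(A)$ the Verschiebung $(a_1,\dots,a_n)\mapsto(0,a_1,\dots,a_n)$, $\Phi_A\colon W_{n+1}(A)\to W_{n+1}(A)$ the map $(a_1,\dots,a_{n+1})\mapsto(a_1^p,\dots,a_{n+1}^p)$ induced by the Frobenius of $A$, and $V^iW_{n+1}(A)\subset W_{n+1}(A)$ the set of Witt vectors whose first $i$ coordinates vanish, i.e. the image of $V^i$. Then for all $n\ge 1$, $1\le j\le d$ and $r\ge 0$: \begin{align*} \partial_{j,n}^{[r/p]}\circ R&=R\circ\partial_{j,n+1}^{[r]},\\ \partial_{j,n+1}^{[r]}\circ\Phi_A&=\Phi_A\circ\partial_{j,n+1}^{[r/p]},\\ \partial_{j,n+1}^{[r]}\circ V&=V\circ\partial_{j,n}^{[r]},\\ \partial_{j,n+1}^{[r]}\bigl(V^iW_{n+1}(A)\bigr)&\subset V^iW_{n+1}(A)\qquad\text{for all }0\le i<n+1, \end{align*} where $\partial_{j,n}^{[r/p]}$ and $\partial_{j,n+1}^{[r/p]}$ are understood to be $0$ if $p\nmid r$. The second and fourth relations also hold for $n=0$. For $\mathbf r=(r_1,\dots,r_d)\in\mathbb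 N^d$ put $\partial_n^{[\mathbf r]}=\partial_{1,n}^{[r_1]}\circ\cdots\circ\partial_{d,n}^{[r_d]}$ on $W_n(A)$ and $\partial_n^{[\mathbf r/p]}=\partial_{1,n}^{[r_1/p]}\circ\cdots\circ\partial_{d,n}^{[r_d/p]}$ (so it is $0$ if $p\nmid r_j$ for some $j$). Then the same four relations hold with $\partial_{j}^{[r]}$, $\partial_j^{[r/p]}$ replaced by $\partial^{[\mathbf r]}$, $\partial^{[\mathbf r/p]}$. -/

import Mathlib

noncomputable section

namespace WittDiff

section TruncatedMaps

variable {p : ℕ} [Fact p.Prime]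

/-- The ring homomorphism `W_n(f) : W_n(R) → W_n(S)` induced by `f : R → S`; it acts
coordinatewise by `f`. -/
def truncMap (n : ℕ) {R S : Type*} [CommRing R] [CommRing S] (f : R →+* S) :
    TruncatedWittVector p n R →+* TruncatedWittVector p n S :=
  have key : ∀ a : WittVector p R,
      TruncatedWittVector.mk p (fun i : Fin n => f ((WittVector.truncate n a).coeff i)) =
        WittVector.truncate n (WittVector.map f a) := fun a => by
    ext i
    simp [WittVector.coeff_truncate, WittVector.map_coeff]
  { toFun := fun x => TruncatedWittVector.mk p fun i => f (x.coeff i)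
    map_one' := by
      rw [← map_one (WittVector.truncate (p := p) (R := R) n), key, map_one, map_one]
    map_zero' := by
      rw [← map_zero (WittVector.truncate (p := p) (R := R) n), key, map_zero, map_zero]
    map_mul' := fun x y => by
      obtain ⟨a, rfl⟩ := WittVector.truncate_surjective p n R x
      obtain ⟨b, rfl⟩ := WittVector.truncate_surjective p n R y
      rw [← map_mul, key, key, key, map_mul, map_mul]
    map_add' := fun x y => by
      obtain ⟨a, rfl⟩ := WittVector.truncate_surjective p n R x
      obtain ⟨b, rfl⟩ := WittVector.truncate_surjective p n R y
      rw [← map_add, key, key, key, map_add, map_add] }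

/-- The restriction `R : W_{n+1}(S) → W_n(S)`, dropping the last coordinate. -/
def res (n : ℕ) {S : Type*} [CommRing S] :
    TruncatedWittVector p (n + 1) S →+* TruncatedWittVector p n S :=
  TruncatedWittVector.truncate (Nat.le_succ n)

/-- The Verschiebung `V : W_n(S) → W_{n+1}(S)`, `(a₁, …, aₙ) ↦ (0, a₁, …, aₙ)`. -/
def ver (n : ℕ) {S : Type*} [CommRing S] (x : TruncatedWittVector p n S) :
    TruncatedWittVector p (n + 1) S :=
  TruncatedWittVector.mk p (Fin.cons 0 fun i : Fin n => x.coeff i)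

/-- `V^i W_{n+1}(S)`, the image of the `i`-fold iterate of the endomorphism
`(a₁, …, aₙ₊₁) ↦ (0, a₁, …, aₙ)` of `W_{n+1}(S)`. -/
def verFil (p : ℕ) [Fact p.Prime] (n i : ℕ) (S : Type*) [CommRing S] :
    Set (TruncatedWittVector p (n + 1) S) :=
  Set.range (fun x : TruncatedWittVector p (n + 1) S => ver n (res n x))^[i]

end TruncatedMaps

section DifferentialOperators

/-- `δ` is an `R`-linear differential operator on `B` of order `≤ m`, in the sense of
Grothendieck. -/
def IsDiffOp {R B : Type*} [CommRing R] [CommRing B] [Algebra R B] :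
    ℕ → Module.End R B → Prop
  | 0, δ => ∀ b : B, δ * LinearMap.mulLeft R b - LinearMap.mulLeft R b * δ = 0
  | m + 1, δ => ∀ b : B, IsDiffOp m (δ * LinearMap.mulLeft R b - LinearMap.mulLeft R b * δ)

/-- The `r`-th divided power `∂_j^{[r]} = (1/r!) (∂/∂t_j)^r` of the partial derivative on a
polynomial ring: `t^e ↦ (e_j choose r) t^(e - r·1_j)` (which is `0` if `e_j < r`). -/
def hasse (R : Type*) [CommRing R] {d : ℕ} (j : Fin d) (r : ℕ) :
    Module.End R (MvPolynomial (Fin d) R) :=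
  (MvPolynomial.basisMonomials (Fin d) R).constr R fun e =>
    MvPolynomial.monomial (e - Finsupp.single j r) ((e j).choose r : R)

end DifferentialOperators

section Ghost

variable (p : ℕ) [Fact p.Prime] (k : Type*) [Field k]

/-- A lift to `A_n = W_n(k)[t₁,…,t_d]` of `f ∈ A = k[t₁,…,t_d]`, obtained by taking
Teichmüller representatives of the coefficients. -/
def polyLift (n : ℕ) {d : ℕ} (f : MvPolynomial (Fin d) k) :
    MvPolynomial (Fin d) (TruncatedWittVector p n k) :=
  ∑ e ∈ f.support, MvPolynomial.monomial e
    (WittVector.truncate n (WittVector.teichmuller p (f.coeff e)))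

/-- The map `W_n(A) → A_n` through which the top ghost component `W_n(A_n) → A_n` factors:
`(f₁, …, fₙ) ↦ ∑ p^(i-1) g_i^(p^(n-i))`, where `g_i ∈ A_n` is a lift of `f_i ∈ A`. The value does
not depend on the lifts, see `ghostTilde_eq`. -/
def ghostTilde (n : ℕ) {d : ℕ} (x : TruncatedWittVector p n (MvPolynomial (Fin d) k)) :
    MvPolynomial (Fin d) (TruncatedWittVector p n k) :=
  ∑ i : Fin n, (p : MvPolynomial (Fin d) (TruncatedWittVector p n k)) ^ (i : ℕ) *
    polyLift p k n (x.coeff i) ^ p ^ (n - 1 - (i : ℕ))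

theorem truncated_p_pow [CharP k p] (n : ℕ) : (p : TruncatedWittVector p n k) ^ n = 0 := by
  have h : (p : TruncatedWittVector p n k) ^ n =
      WittVector.truncate n ((p : WittVector p k) ^ n) := by simp
  rw [h]
  ext i
  rw [WittVector.coeff_truncate, TruncatedWittVector.coeff_zero]
  exact WittVector.coeff_p_pow_eq_zero p k (ne_of_lt i.2)

theorem truncated_p_dvd [CharP k p] [PerfectRing k p] (n : ℕ)
    (x : TruncatedWittVector p (n + 1) k) (hx : x.coeff 0 = 0) :
    (p : TruncatedWittVector p (n + 1) k) ∣ x := by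
  obtain ⟨y, rfl⟩ := WittVector.truncate_surjective p (n + 1) k x
  have hy : y.coeff 0 = 0 := by simpa [WittVector.coeff_truncate] using hx
  have h1 : WittVector.verschiebung (y.shift 1) = y := by
    have := WittVector.verschiebung_shift y 0 (by intro i hi; interval_cases i; exact hy)
    simpa [WittVector.shift] using this
  obtain ⟨z, hz⟩ := (WittVector.frobeniusEquiv p k).surjective (y.shift 1)
  have h2 : y = z * p := by
    rw [← h1, ← hz]
    exact WittVector.verschiebung_frobenius z
  exact ⟨WittVector.truncate (n + 1) z, by rw [h2]; simp [mul_comm]⟩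

/-- `ghostTilde` may be computed with arbitrary lifts `g i` of the coordinates. -/
theorem ghostTilde_eq [CharP k p] [PerfectRing k p] (n : ℕ) {d : ℕ}
    (x : TruncatedWittVector p (n + 1) (MvPolynomial (Fin d) k))
    (g : Fin (n + 1) → MvPolynomial (Fin d) (TruncatedWittVector p (n + 1) k))
    (hg : ∀ i e, ((g i).coeff e).coeff 0 = (x.coeff i).coeff e) :
    ghostTilde p k (n + 1) x =
      ∑ i : Fin (n + 1), (p : MvPolynomial (Fin d) (TruncatedWittVector p (n + 1) k)) ^ (i : ℕ) *
        g i ^ p ^ (n - (i : ℕ)) := by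
  have hsub : ∀ a b : TruncatedWittVector p (n + 1) k, a.coeff 0 = b.coeff 0 →
      (a - b).coeff 0 = 0 := by
    intro a b hab
    obtain ⟨a, rfl⟩ := WittVector.truncate_surjective p (n + 1) k a
    obtain ⟨b, rfl⟩ := WittVector.truncate_surjective p (n + 1) k b
    rw [WittVector.coeff_truncate, WittVector.coeff_truncate] at hab
    rw [← map_sub, WittVector.coeff_truncate]
    have := map_sub (WittVector.constantCoeff : WittVector p k →+* k) a b
    simp only [WittVector.constantCoeff_apply] at this
    simp only [Fin.val_zero] at hab ⊢
    rw [this, hab, sub_self]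
  have hp : (p : MvPolynomial (Fin d) (TruncatedWittVector p (n + 1) k)) ^ (n + 1) = 0 := by
    have := congrArg (MvPolynomial.C (σ := Fin d)) (truncated_p_pow p k (n + 1))
    simpa using this
  refine Finset.sum_congr rfl fun i _ => ?_
  have hL : ∀ e, ((polyLift p k (n + 1) (x.coeff i)).coeff e).coeff 0 = (x.coeff i).coeff e := by
    intro e
    unfold polyLift
    rw [MvPolynomial.coeff_sum]
    simp only [MvPolynomial.coeff_monomial]
    rw [Finset.sum_ite_eq']
    split_ifs with h
    · simp [WittVector.coeff_truncate]
    · rw [TruncatedWittVector.coeff_zero]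
      exact (MvPolynomial.notMem_support_iff.mp h).symm
  have hdvd : (p : MvPolynomial (Fin d) (TruncatedWittVector p (n + 1) k)) ∣
      polyLift p k (n + 1) (x.coeff i) - g i := by
    have : (p : MvPolynomial (Fin d) (TruncatedWittVector p (n + 1) k)) =
        MvPolynomial.C (p : TruncatedWittVector p (n + 1) k) := by simp
    rw [this, MvPolynomial.C_dvd_iff_dvd_coeff]
    intro e
    apply truncated_p_dvd
    rw [MvPolynomial.coeff_sub]
    exact hsub _ _ ((hL e).trans (hg i e).symm)
  obtain ⟨c, hc⟩ := dvd_sub_pow_of_dvd_sub hdvd (n - (i : ℕ))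
  rw [← sub_eq_zero, ← mul_sub, Nat.add_sub_cancel, hc, ← mul_assoc, ← pow_add,
    show (i : ℕ) + (n - (i : ℕ) + 1) = n + 1 by omega, hp, zero_mul]

end Ghost

section Operators

variable (p : ℕ) [Fact p.Prime] (k : Type*) [Field k]

/-- The canonical `W_n(k)`-algebra structure on `W_n(k[t₁,…,t_d])`. -/
instance truncAlgebra (n d : ℕ) :
    Algebra (TruncatedWittVector p n k) (TruncatedWittVector p n (MvPolynomial (Fin d) k)) :=
  (truncMap n (algebraMap k (MvPolynomial (Fin d) k))).toAlgebra

/-- `δ` is the restriction to `W_n(A)` of the operator `D` on `A_n`: a `W_n(k)`-linear differential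
operator on `W_n(A)` (of some order) which is compatible with `D` under `ghostTilde`. -/
def IsRestriction {n d : ℕ}
    (D : Module.End (TruncatedWittVector p n k)
      (MvPolynomial (Fin d) (TruncatedWittVector p n k)))
    (δ : Module.End (TruncatedWittVector p n k)
      (TruncatedWittVector p n (MvPolynomial (Fin d) k))) : Prop :=
  (∃ m, IsDiffOp m δ) ∧ ∀ x, ghostTilde p k n (δ x) = D (ghostTilde p k n x)

open Classical in
/-- The restriction of `D` to `W_n(A)` (and `0` if there is none). -/
def restriction {n d : ℕ}
    (D : Module.End (TruncatedWittVector p n k)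
      (MvPolynomial (Fin d) (TruncatedWittVector p n k))) :
    Module.End (TruncatedWittVector p n k)
      (TruncatedWittVector p n (MvPolynomial (Fin d) k)) :=
  if h : ∃ δ, IsRestriction p k D δ then h.choose else 0

/-- The Witt differential operator `∂_{j,n}^{[r]} : W_n(A) → W_n(A)`. -/
def wittDiffOp (n : ℕ) {d : ℕ} (j : Fin d) (r : ℕ) :
    Module.End (TruncatedWittVector p n k)
      (TruncatedWittVector p n (MvPolynomial (Fin d) k)) :=
  restriction p k (hasse (TruncatedWittVector p n k) j r)

/-- `∂_{j,n}^{[r/p]}`, meant to be `0` if `p ∤ r`. -/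
def wittDiffOpDiv (n : ℕ) {d : ℕ} (j : Fin d) (r : ℕ) :
    Module.End (TruncatedWittVector p n k)
      (TruncatedWittVector p n (MvPolynomial (Fin d) k)) :=
  if p ∣ r then wittDiffOp p k n j (r / p) else 0

/-- `∂_n^{[𝐫]} = ∂_{1,n}^{[r₁]} ∘ ⋯ ∘ ∂_{d,n}^{[r_d]}` on `W_n(A)`. -/
def wittDiffOpMulti (n : ℕ) {d : ℕ} (r : Fin d → ℕ) :
    Module.End (TruncatedWittVector p n k)
      (TruncatedWittVector p n (MvPolynomial (Fin d) k)) :=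
  (List.ofFn fun j => wittDiffOp p k n j (r j)).prod

/-- `∂_n^{[𝐫/p]} = ∂_{1,n}^{[r₁/p]} ∘ ⋯ ∘ ∂_{d,n}^{[r_d/p]}`; it is `0` if `p ∤ r_j` for some `j`. -/
def wittDiffOpMultiDiv (n : ℕ) {d : ℕ} (r : Fin d → ℕ) :
    Module.End (TruncatedWittVector p n k)
      (TruncatedWittVector p n (MvPolynomial (Fin d) k)) :=
  (List.ofFn fun j => wittDiffOpDiv p k n j (r j)).prod

/-- `Φ_A : W_n(A) → W_n(A)`, induced by the Frobenius `f ↦ f^p` of `A = k[t₁,…,t_d]`. -/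
def frobA [CharP k p] (n d : ℕ) :
    TruncatedWittVector p n (MvPolynomial (Fin d) k) →+*
      TruncatedWittVector p n (MvPolynomial (Fin d) k) :=
  truncMap n (frobenius (MvPolynomial (Fin d) k) p)

end Operators

end WittDiff

end

/-!
For `n ≥ 1` the map `ghostTilde` is an injective ring homomorphism `W_n(A) → A_n`, and its image
consists of the polynomials whose differential is divisible by `p ^ (n - 1)`. The operators `hasse`
commute with the partial derivatives, so they preserve this image and restrict to `W_n(A)`;
uniqueness and the bound on the order follow from injectivity.

The relations are checked inside `A_n`. There `V` is multiplication by `p` of a lift along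
`A_{n+1} → A_n`, `Φ_A` is the Frobenius lift `F` with `t_j ↦ t_j ^ p`, and `F` applied to the image
of `R x` is the reduction of the image of `x`. The division of `r` by `p` comes from the congruence
`(p e choose r) ≡ (e choose r/p)` modulo `p ^ (v_p(e) + 1)`: it gives `∂^[r] ∘ F = F ∘ ∂^[r/p]` on
polynomials whose differential is killed by `p`. Finally `∂^[r]` preserves the filtration because
`∂^[r] ∘ VR = VR ∘ ∂^[p r]`.
-/

namespace WittDiff

section DifferentialOperators

variable {R B : Type*} [CommRing R] [CommRing B] [Algebra R B]

/-- The commutator `δ ↦ [δ, b]` with multiplication by `b`, which is what the definition of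
`IsDiffOp` iterates. -/
def mulCommutator (b : B) : Module.End R B →ₗ[R] Module.End R B :=
  LinearMap.mulRight R (LinearMap.mulLeft R b) - LinearMap.mulLeft R (LinearMap.mulLeft R b)

theorem mulCommutator_apply (b : B) (δ : Module.End R B) (x : B) :
    mulCommutator b δ x = δ (b * x) - b * δ x :=
  rfl

theorem isDiffOp_zero_iff {δ : Module.End R B} :
    IsDiffOp 0 δ ↔ ∀ b : B, mulCommutator b δ = 0 :=
  Iff.rfl

theorem isDiffOp_succ_iff {m : ℕ} {δ : Module.End R B} :
    IsDiffOp (m + 1) δ ↔ ∀ b : B, IsDiffOp m (mulCommutator b δ) :=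
  Iff.rfl

theorem IsDiffOp.zero (m : ℕ) : IsDiffOp m (0 : Module.End R B) := by
  induction m with
  | zero => exact isDiffOp_zero_iff.mpr fun b => map_zero _
  | succ m ih => exact isDiffOp_succ_iff.mpr fun b => by rwa [map_zero]

theorem IsDiffOp.add {m : ℕ} {δ ε : Module.End R B} (hδ : IsDiffOp m δ) (hε : IsDiffOp m ε) :
    IsDiffOp m (δ + ε) := by
  induction m generalizing δ ε with
  | zero =>
    exact isDiffOp_zero_iff.mpr fun b => by
      rw [map_add, isDiffOp_zero_iff.mp hδ, isDiffOp_zero_iff.mp hε, add_zero]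
  | succ m ih =>
    exact isDiffOp_succ_iff.mpr fun b => by
      rw [map_add]
      exact ih (isDiffOp_succ_iff.mp hδ b) (isDiffOp_succ_iff.mp hε b)

theorem IsDiffOp.sum {ι : Type*} {m : ℕ} (s : Finset ι) {δ : ι → Module.End R B}
    (h : ∀ i ∈ s, IsDiffOp m (δ i)) : IsDiffOp m (∑ i ∈ s, δ i) :=
  Finset.sum_induction _ _ (fun _ _ => IsDiffOp.add) (IsDiffOp.zero m) h

theorem mulCommutator_mulLeft_mul (a b : B) (δ : Module.End R B) :
    mulCommutator b (LinearMap.mulLeft R a * δ) = LinearMap.mulLeft R a * mulCommutator b δ := by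
  ext x
  simp only [mulCommutator_apply, Module.End.mul_apply, LinearMap.mulLeft_apply]
  ring

theorem IsDiffOp.mulLeft_mul {m : ℕ} {δ : Module.End R B} (h : IsDiffOp m δ) (a : B) :
    IsDiffOp m (LinearMap.mulLeft R a * δ) := by
  induction m generalizing δ with
  | zero =>
    exact isDiffOp_zero_iff.mpr fun b => by
      rw [mulCommutator_mulLeft_mul, isDiffOp_zero_iff.mp h, mul_zero]
  | succ m ih =>
    exact isDiffOp_succ_iff.mpr fun b => by
      rw [mulCommutator_mulLeft_mul]
      exact ih (isDiffOp_succ_iff.mp h b)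

theorem IsDiffOp.succ {m : ℕ} {δ : Module.End R B} (h : IsDiffOp m δ) : IsDiffOp (m + 1) δ := by
  induction m generalizing δ with
  | zero => exact isDiffOp_succ_iff.mpr fun b => isDiffOp_zero_iff.mp h b ▸ IsDiffOp.zero 0
  | succ m ih => exact isDiffOp_succ_iff.mpr fun b => ih (isDiffOp_succ_iff.mp h b)

theorem IsDiffOp.mono {m n : ℕ} (hmn : m ≤ n) {δ : Module.End R B} (h : IsDiffOp m δ) :
    IsDiffOp n δ :=
  Nat.le_induction h (fun _ _ => IsDiffOp.succ) n hmn

variable {S C : Type*} [CommRing S] [CommRing C] [Algebra S C]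

theorem map_mulCommutator_of_intertwines {w : B →+* C} {D : Module.End S C} {δ : Module.End R B}
    (h : ∀ x, w (δ x) = D (w x)) (b x : B) :
    w (mulCommutator b δ x) = mulCommutator (w b) D (w x) := by
  simp only [mulCommutator_apply, map_sub, map_mul, h]

theorem IsDiffOp.of_injective {w : B →+* C} (hw : Function.Injective w) {m : ℕ}
    {D : Module.End S C} {δ : Module.End R B} (h : ∀ x, w (δ x) = D (w x)) (hD : IsDiffOp m D) :
    IsDiffOp m δ := by
  induction m generalizing D δ with
  | zero =>
    refine isDiffOp_zero_iff.mpr fun b => LinearMap.ext fun x => hw ?_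
    rw [map_mulCommutator_of_intertwines h, isDiffOp_zero_iff.mp hD, LinearMap.zero_apply,
      LinearMap.zero_apply, map_zero]
  | succ m ih =>
    exact isDiffOp_succ_iff.mpr fun b =>
      ih (map_mulCommutator_of_intertwines h b) (isDiffOp_succ_iff.mp hD (w b))

theorem exists_intertwining_of_injective {w : B →+* C} (hw : Function.Injective w)
    (hconst : ∀ c : R, ∃ b : S, w (algebraMap R B c) = algebraMap S C b) {D : Module.End S C}
    (hD : ∀ x, D (w x) ∈ w.range) : ∃ δ : Module.End R B, ∀ x, w (δ x) = D (w x) := by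
  choose δ hδ using hD
  refine ⟨{ toFun := δ, map_add' := fun x y => hw ?_, map_smul' := fun c x => hw ?_ }, hδ⟩
  · rw [map_add, hδ, hδ, hδ, map_add, map_add]
  · obtain ⟨b, hb⟩ := hconst c
    rw [RingHom.id_apply, Algebra.smul_def, Algebra.smul_def, hδ, map_mul w, map_mul w, hδ, hb,
      ← Algebra.smul_def, ← Algebra.smul_def, map_smul]

end DifferentialOperators

section Binomial

open Polynomial in
theorem prime_dvd_X_add_one_pow_sub_expand (p : ℕ) [Fact p.Prime] :
    (p : ℤ[X]) ∣ (X + 1) ^ p - expand ℤ p (X + 1) := by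
  rw [← map_natCast (C : ℤ →+* ℤ[X]), C_dvd_iff_dvd_coeff]
  intro i
  have hmod : ((X + 1) ^ p - expand ℤ p (X + 1)).map (Int.castRingHom (ZMod p)) = 0 := by
    simp [add_pow_char]
  have hcoeff := congrArg (coeff · i) hmod
  simp only [coeff_map, coeff_zero, eq_intCast] at hcoeff
  exact (ZMod.intCast_zmod_eq_zero_iff_dvd _ _).mp hcoeff

open Polynomial in
theorem prime_pow_succ_dvd_choose_mul_sub {p : ℕ} [Fact p.Prime] {v e : ℕ} (hv : p ^ v ∣ e)
    (r : ℕ) :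
    (p : ℤ) ^ (v + 1) ∣ ((p * e).choose r : ℤ) -
      if p ∣ r then (e.choose (r / p) : ℤ) else 0 := by
  obtain ⟨u, rfl⟩ := hv
  have hpow : (p : ℤ[X]) ^ (v + 1) ∣
      (X + 1) ^ (p * (p ^ v * u)) - expand ℤ p ((X + 1) ^ (p ^ v * u)) := by
    have h := (dvd_sub_pow_of_dvd_sub (prime_dvd_X_add_one_pow_sub_expand p) v).trans
      (sub_dvd_pow_sub_pow _ _ u)
    rwa [← pow_mul, ← pow_mul, ← pow_mul, ← map_pow] at h
  rw [← map_natCast (C : ℤ →+* ℤ[X]), ← map_pow, C_dvd_iff_dvd_coeff] at hpow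
  have hcoeff := hpow r
  rw [coeff_sub, coeff_X_add_one_pow, coeff_expand (Fact.out : p.Prime).pos,
    coeff_X_add_one_pow] at hcoeff
  simpa using hcoeff

variable {p n : ℕ} [Fact p.Prime] {S : Type*} [CommRing S]

theorem isUnit_natCast_of_not_dvd (hS : (p : S) ^ n = 0) {u : ℕ} (hu : ¬p ∣ u) :
    IsUnit (u : S) := by
  have hcop : Nat.Coprime u (p ^ n) :=
    ((Fact.out : p.Prime).coprime_iff_not_dvd.mpr hu).symm.pow_right n
  obtain ⟨a, b, hab⟩ := Nat.isCoprime_iff_coprime.mpr hcop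
  have hcast := congrArg (Int.cast : ℤ → S) hab
  push_cast at hcast
  rw [hS, mul_zero, add_zero] at hcast
  exact IsUnit.of_mul_eq_one_right _ hcast

/-- For `e ≠ 0` the exponent is the `p`-adic valuation of `e`; for `e = 0` it is `n`. -/
theorem exists_pow_dvd_and_associated_natCast (hS : (p : S) ^ n = 0) (e : ℕ) :
    ∃ v, p ^ v ∣ e ∧ Associated (e : S) ((p : S) ^ v) := by
  rcases eq_or_ne e 0 with rfl | he
  · exact ⟨n, dvd_zero _, by rw [hS, Nat.cast_zero]⟩
  · obtain ⟨v, u, hu, rfl⟩ := Nat.exists_eq_pow_mul_and_not_dvd he p (Fact.out : p.Prime).ne_one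
    refine ⟨v, dvd_mul_right _ _, ?_⟩
    rw [Nat.cast_mul, Nat.cast_pow]
    exact associated_mul_unit_left _ _ (isUnit_natCast_of_not_dvd hS hu)

theorem natCast_choose_prime_mul_mul (hS : (p : S) ^ n = 0) {e : ℕ} {a : S}
    (ha : (p : S) * ((e : S) * a) = 0) (r : ℕ) :
    ((p * e).choose r : S) * a = if p ∣ r then (e.choose (r / p) : S) * a else 0 := by
  obtain ⟨v, hv, hassoc⟩ := exists_pow_dvd_and_associated_natCast hS e
  have hpa : (p : S) ^ (v + 1) * a = 0 := by
    obtain ⟨w, hw⟩ := hassoc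
    rw [pow_succ, ← hw]
    linear_combination (w : S) * ha
  obtain ⟨c, hc⟩ := prime_pow_succ_dvd_choose_mul_sub hv r
  have hcast := congrArg (Int.cast : ℤ → S) hc
  push_cast at hcast
  rw [← ite_zero_mul, ← sub_eq_zero, ← sub_mul, hcast, mul_right_comm, hpa, zero_mul]

end Binomial

open MvPolynomial

section Hasse

variable {R : Type*} [CommRing R] {d : ℕ}

theorem hasse_monomial (j : Fin d) (r : ℕ) (e : Fin d →₀ ℕ) (a : R) :
    hasse R j r (monomial e a) =
      monomial (e - Finsupp.single j r) (((e j).choose r : R) * a) := by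
  have h : monomial e a = a • basisMonomials (Fin d) R e := by
    rw [coe_basisMonomials, smul_monomial, smul_eq_mul, mul_one]
  rw [h, map_smul, hasse, Module.Basis.constr_basis, smul_monomial, smul_eq_mul, mul_comm]

theorem coeff_hasse (j : Fin d) (r : ℕ) (f : MvPolynomial (Fin d) R) (e : Fin d →₀ ℕ) :
    coeff e (hasse R j r f) =
      ((e j + r).choose r : R) * coeff (e + Finsupp.single j r) f := by
  induction f using MvPolynomial.induction_on' with
  | add f g hf hg => rw [map_add, coeff_add, hf, hg, coeff_add, mul_add]
  | monomial u a =>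
    rw [hasse_monomial, coeff_monomial, coeff_monomial]
    rcases lt_or_ge (u j) r with hlt | hle
    · have hu : u ≠ e + Finsupp.single j r := by
        rintro rfl
        simp at hlt
      rw [if_neg hu, Nat.choose_eq_zero_of_lt hlt, Nat.cast_zero, zero_mul, ite_self, mul_zero]
    · have hiff : u - Finsupp.single j r = e ↔ u = e + Finsupp.single j r :=
        tsub_eq_iff_eq_add_of_le (by simpa using hle)
      by_cases hu : u = e + Finsupp.single j r
      · simp [hu]
      · rw [if_neg (hiff.not.mpr hu), if_neg hu, mul_zero]

theorem hasse_zero (j : Fin d) : hasse R j 0 = 1 := by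
  refine LinearMap.ext fun f => MvPolynomial.ext _ _ fun e => ?_
  simp [coeff_hasse]

theorem map_hasse {S : Type*} [CommRing S] (f : R →+* S) (j : Fin d) (r : ℕ)
    (g : MvPolynomial (Fin d) R) : map f (hasse R j r g) = hasse S j r (map f g) := by
  ext e
  simp [coeff_hasse, coeff_map]

theorem pderiv_hasse (i j : Fin d) (r : ℕ) (f : MvPolynomial (Fin d) R) :
    pderiv i (hasse R j r f) = hasse R j r (pderiv i f) := by
  ext e
  rw [coeff_pderiv, coeff_hasse, coeff_hasse, coeff_pderiv, add_right_comm e]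
  by_cases hij : i = j
  · subst hij
    have hchoose : (e i + r).choose r * (e i + r + 1) = (e i + 1 + r).choose r * (e i + 1) := by
      rw [Nat.choose_mul_succ_eq, add_right_comm, Nat.add_sub_cancel]
    have hcast := congrArg (Nat.cast : ℕ → R) hchoose
    push_cast at hcast
    simp only [Finsupp.add_apply, Finsupp.single_eq_same, Nat.cast_add]
    linear_combination -coeff (e + Finsupp.single i r + Finsupp.single i 1) f * hcast
  · simp only [Finsupp.add_apply, Finsupp.single_eq_of_ne' hij,
      Finsupp.single_eq_of_ne' (Ne.symm hij), add_zero, mul_assoc]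

theorem hasse_monomial_mul_hasse_monomial (j : Fin d) (s t : ℕ) (u v : Fin d →₀ ℕ) (a b : R) :
    hasse R j s (monomial u a) * hasse R j t (monomial v b) =
      monomial (u + v - Finsupp.single j (s + t))
        ((((u j).choose s * (v j).choose t : ℕ) : R) * (a * b)) := by
  rw [hasse_monomial, hasse_monomial, monomial_mul]
  rcases lt_or_ge (u j) s with hu | hu
  · simp [Nat.choose_eq_zero_of_lt hu]
  rcases lt_or_ge (v j) t with hv | hv
  · simp [Nat.choose_eq_zero_of_lt hv]
  rw [Finsupp.single_add, tsub_add_tsub_comm (by simpa using hu) (by simpa using hv), Nat.cast_mul,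
    mul_mul_mul_comm]

theorem hasse_mul (j : Fin d) (r : ℕ) (f g : MvPolynomial (Fin d) R) :
    hasse R j r (f * g) =
      ∑ s ∈ Finset.HasAntidiagonal.antidiagonal r, hasse R j s.1 f * hasse R j s.2 g := by
  induction f using MvPolynomial.induction_on' with
  | add f₁ f₂ h₁ h₂ => simp only [add_mul, map_add, h₁, h₂, Finset.sum_add_distrib]
  | monomial u a =>
    induction g using MvPolynomial.induction_on' with
    | add g₁ g₂ h₁ h₂ => simp only [mul_add, map_add, h₁, h₂, Finset.sum_add_distrib]
    | monomial v b =>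
      have hterm : ∀ s ∈ Finset.HasAntidiagonal.antidiagonal r,
          hasse R j s.1 (monomial u a) * hasse R j s.2 (monomial v b) =
            monomial (u + v - Finsupp.single j r)
              ((((u j).choose s.1 * (v j).choose s.2 : ℕ) : R) * (a * b)) := fun s hs => by
        rw [hasse_monomial_mul_hasse_monomial, Finset.HasAntidiagonal.mem_antidiagonal.mp hs]
      rw [Finset.sum_congr rfl hterm, monomial_mul, hasse_monomial, ← map_sum, ← Finset.sum_mul,
        Finsupp.add_apply, Nat.add_choose_eq, Nat.cast_sum]

theorem mulCommutator_hasse_succ (j : Fin d) (r : ℕ) (b : MvPolynomial (Fin d) R) :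
    mulCommutator b (hasse R j (r + 1)) =
      ∑ s ∈ Finset.HasAntidiagonal.antidiagonal r,
        LinearMap.mulLeft R (hasse R j (s.1 + 1) b) * hasse R j s.2 := by
  refine LinearMap.ext fun f => ?_
  rw [mulCommutator_apply, hasse_mul, Finset.Nat.antidiagonal_succ, Finset.sum_cons,
    Finset.sum_map]
  simp [hasse_zero, LinearMap.sum_apply]

theorem isDiffOp_hasse (j : Fin d) (r : ℕ) : IsDiffOp r (hasse R j r) := by
  induction r using Nat.strong_induction_on with
  | _ r ih =>
    cases r with
    | zero =>
      exact isDiffOp_zero_iff.mpr fun b => LinearMap.ext fun f => by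
        simp [mulCommutator_apply, hasse_zero]
    | succ r =>
      refine isDiffOp_succ_iff.mpr fun b => ?_
      rw [mulCommutator_hasse_succ]
      refine IsDiffOp.sum _ fun s hs => IsDiffOp.mulLeft_mul ?_ _
      have hs2 : s.2 ≤ r := Finset.HasAntidiagonal.antidiagonal.snd_le hs
      exact (ih s.2 (Nat.lt_succ_of_le hs2)).mono hs2

end Hasse

section DividedDifferential

variable {R : Type*} [CommRing R]

theorem coeff_X_mul_pderiv {σ : Type*} (j : σ) (g : MvPolynomial σ R) (e : σ →₀ ℕ) :
    coeff e (X j * pderiv j g) = (e j : R) * coeff e g := by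
  classical
  induction g using MvPolynomial.induction_on' with
  | add f g hf hg => rw [map_add, mul_add, coeff_add, hf, hg, coeff_add, mul_add]
  | monomial u a =>
    rw [X_mul_pderiv_monomial, coeff_smul, coeff_monomial, nsmul_eq_mul]
    split_ifs with h
    · rw [h]
    · rw [mul_zero, mul_zero]

/-- `c` divides the differential `dg`, i.e. every partial derivative of `g`. For
`c = p ^ (n - 1)` and coefficients in `W_n(k)`, this condition cuts out the image of `ghostTilde`,
see `mem_range_ghostHom_iff`. -/
def DvdDifferential {σ : Type*} (c : R) (g : MvPolynomial σ R) : Prop :=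
  ∀ j, C c ∣ pderiv j g

theorem DvdDifferential.dvd_natCast_mul_coeff {σ : Type*} {c : R} {g : MvPolynomial σ R}
    (hg : DvdDifferential c g) (j : σ) (e : σ →₀ ℕ) : c ∣ (e j : R) * coeff e g := by
  rw [← coeff_X_mul_pderiv]
  exact (C_dvd_iff_dvd_coeff _ _).mp ((hg j).mul_left (X j)) e

theorem DvdDifferential.hasse {d : ℕ} {c : R} {g : MvPolynomial (Fin d) R}
    (hg : DvdDifferential c g) (j : Fin d) (r : ℕ) : DvdDifferential c (hasse R j r g) := by
  intro i
  obtain ⟨h, hh⟩ := hg i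
  exact ⟨WittDiff.hasse R j r h, by
    rw [pderiv_hasse, hh, ← smul_eq_C_mul, map_smul, smul_eq_C_mul]⟩

end DividedDifferential

section FrobeniusLift

variable (p : ℕ) {R : Type*} [CommRing R]

/-- The ring endomorphism of a polynomial ring acting by `φ` on the coefficients and sending each
variable to its `p`-th power. It lifts the Frobenius modulo `p` if `φ` does. -/
noncomputable def frobLift {σ : Type*} (φ : R →+* R) : MvPolynomial σ R →+* MvPolynomial σ R :=
  (expand p : _ →ₐ[R] _).toRingHom.comp (map φ)

theorem frobLift_monomial {σ : Type*} (φ : R →+* R) (e : σ →₀ ℕ) (a : R) :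
    frobLift p φ (monomial e a) = monomial (p • e) (φ a) := by
  simp [frobLift, expand_monomial]

theorem frobLift_C {σ : Type*} (φ : R →+* R) (a : R) :
    frobLift p φ (C a : MvPolynomial σ R) = C (φ a) := by
  simp [frobLift]

theorem frobLift_X {σ : Type*} (φ : R →+* R) (j : σ) : frobLift p φ (X j) = X j ^ p := by
  simp [frobLift]

theorem frobLift_injective {p : ℕ} (hp : 0 < p) {σ : Type*} {φ : R →+* R}
    (hφ : Function.Injective φ) :
    Function.Injective (frobLift p φ : MvPolynomial σ R →+* MvPolynomial σ R) :=
  (expand_injective hp).comp (map_injective φ hφ)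

variable {p} {n d : ℕ} [Fact p.Prime]

theorem hasse_frobLift_monomial (hR : (p : R) ^ n = 0) (φ : R →+* R) (j : Fin d) (r : ℕ)
    {e : Fin d →₀ ℕ} {a : R} (ha : (p : R) * ((e j : R) * a) = 0) :
    hasse R j r (frobLift p φ (monomial e a)) =
      if p ∣ r then frobLift p φ (hasse R j (r / p) (monomial e a)) else 0 := by
  have hφa : (p : R) * ((e j : R) * φ a) = 0 := by
    simpa only [map_mul, map_natCast, map_zero] using congrArg φ ha
  rw [frobLift_monomial, hasse_monomial, Finsupp.smul_apply, smul_eq_mul,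
    natCast_choose_prime_mul_mul hR hφa]
  split_ifs with hr
  · obtain ⟨s, rfl⟩ := hr
    rw [Nat.mul_div_cancel_left _ (Fact.out : p.Prime).pos, hasse_monomial, frobLift_monomial,
      map_mul φ, map_natCast φ]
    refine congrArg (fun u => monomial u (((e j).choose s : R) * φ a)) (Finsupp.ext fun i => ?_)
    by_cases hij : j = i
    · subst hij
      simp [Nat.mul_sub]
    · simp [Finsupp.single_eq_of_ne' hij]
  · rw [map_zero]

theorem hasse_frobLift (hR : (p : R) ^ n = 0) (φ : R →+* R) {j : Fin d}
    {g : MvPolynomial (Fin d) R} (hg : C (p : R) * pderiv j g = 0) (r : ℕ) :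
    hasse R j r (frobLift p φ g) =
      if p ∣ r then frobLift p φ (hasse R j (r / p) g) else 0 := by
  have hcoeff : ∀ e : Fin d →₀ ℕ, (p : R) * ((e j : R) * coeff e g) = 0 := fun e => by
    rw [← coeff_X_mul_pderiv, ← coeff_C_mul, mul_left_comm, hg, mul_zero, coeff_zero]
  rw [g.as_sum]
  simp only [map_sum, hasse_frobLift_monomial hR φ j r (hcoeff _)]
  split_ifs
  · rfl
  · exact Finset.sum_const_zero

end FrobeniusLift

section TruncatedWittVectors

theorem subsingleton_truncatedWittVector_zero (p : ℕ) (S : Type*) :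
    Subsingleton (TruncatedWittVector p 0 S) :=
  ⟨fun _ _ => TruncatedWittVector.ext fun i => i.elim0⟩

variable {p : ℕ} [Fact p.Prime]

theorem coeff_truncMap {n : ℕ} {R S : Type*} [CommRing R] [CommRing S] (f : R →+* S)
    (x : TruncatedWittVector p n R) (i : Fin n) : (truncMap n f x).coeff i = f (x.coeff i) :=
  TruncatedWittVector.coeff_mk _ _

theorem truncMap_injective (n : ℕ) {R S : Type*} [CommRing R] [CommRing S] {f : R →+* S}
    (hf : Function.Injective f) : Function.Injective (truncMap (p := p) n f) := fun x y h =>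
  TruncatedWittVector.ext fun i => hf <| by rw [← coeff_truncMap, h, coeff_truncMap]

theorem truncMap_surjective (n : ℕ) {R S : Type*} [CommRing R] [CommRing S] {f : R →+* S}
    (hf : Function.Surjective f) : Function.Surjective (truncMap (p := p) n f) := fun y => by
  choose x hx using fun i => hf (y.coeff i)
  exact ⟨TruncatedWittVector.mk p x, TruncatedWittVector.ext fun i => by
    rw [coeff_truncMap, TruncatedWittVector.coeff_mk, hx]⟩

variable (p) in
/-- The residue map `W_{m+1}(S) → S`, taking a Witt vector to its zeroth coordinate. -/
noncomputable def residue (m : ℕ) (S : Type*) [CommRing S] :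
    TruncatedWittVector p (m + 1) S →+* S where
  toFun x := x.coeff 0
  map_one' := by
    rw [← map_one (WittVector.truncate (p := p) (R := S) (m + 1)), WittVector.coeff_truncate]
    exact WittVector.one_coeff_zero p S
  map_zero' := TruncatedWittVector.coeff_zero _ _ _ _
  map_mul' x y := by
    obtain ⟨a, rfl⟩ := WittVector.truncate_surjective p (m + 1) S x
    obtain ⟨b, rfl⟩ := WittVector.truncate_surjective p (m + 1) S y
    simp only [← map_mul, WittVector.coeff_truncate]
    exact map_mul WittVector.constantCoeff a b
  map_add' x y := by
    obtain ⟨a, rfl⟩ := WittVector.truncate_surjective p (m + 1) S x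
    obtain ⟨b, rfl⟩ := WittVector.truncate_surjective p (m + 1) S y
    simp only [← map_add, WittVector.coeff_truncate]
    exact map_add WittVector.constantCoeff a b

theorem residue_apply {m : ℕ} {S : Type*} [CommRing S] (x : TruncatedWittVector p (m + 1) S) :
    residue p m S x = x.coeff 0 :=
  rfl

section CharP

variable {S : Type*} [CommRing S] [CharP S p]

theorem residue_eq_zero_of_p_pow_mul_eq_zero [IsReduced S] {m i : ℕ} (hi : i ≤ m)
    {c : TruncatedWittVector p (m + 1) S} (h : (p : TruncatedWittVector p (m + 1) S) ^ i * c = 0) :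
    residue p m S c = 0 := by
  obtain ⟨y, rfl⟩ := WittVector.truncate_surjective p (m + 1) S c
  have hker : WittVector.truncate (m + 1) (y * (p : WittVector p S) ^ i) = 0 := by
    rw [map_mul, map_pow, map_natCast, mul_comm, h]
  have hcoeff : (y * (p : WittVector p S) ^ i).coeff (0 + i) = 0 :=
    (WittVector.mem_ker_truncate (m + 1) _).mp hker _ (by omega)
  rw [WittVector.mul_pow_charP_coeff_succ] at hcoeff
  rw [residue_apply, WittVector.coeff_truncate]
  exact eq_zero_of_pow_eq_zero hcoeff

theorem p_mul_eq_zero_of_res_eq_zero {n : ℕ} {c : TruncatedWittVector p (n + 1) S}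
    (h : res n c = 0) : (p : TruncatedWittVector p (n + 1) S) * c = 0 := by
  obtain ⟨y, rfl⟩ := WittVector.truncate_surjective p (n + 1) S c
  rw [res, TruncatedWittVector.truncate_wittVector_truncate] at h
  have hy := (WittVector.mem_ker_truncate n y).mp h
  rw [mul_comm, ← map_natCast (WittVector.truncate (p := p) (R := S) (n + 1)), ← map_mul]
  refine (WittVector.mem_ker_truncate (n + 1) _).mpr fun i hi => ?_
  cases i with
  | zero => exact WittVector.mul_charP_coeff_zero y
  | succ i =>
    rw [WittVector.mul_charP_coeff_succ, hy i (by omega), zero_pow (Fact.out : p.Prime).ne_zero]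

end CharP

variable {k : Type*} [Field k] [CharP k p] [PerfectRing k p] {m : ℕ}

theorem p_pow_dvd_of_p_pow_mul_eq_zero {v l : ℕ} (hvl : v + l ≤ m + 1)
    {c : TruncatedWittVector p (m + 1) k} (h : (p : TruncatedWittVector p (m + 1) k) ^ v * c = 0) :
    (p : TruncatedWittVector p (m + 1) k) ^ l ∣ c := by
  induction l with
  | zero => rw [pow_zero]; exact one_dvd c
  | succ l ih =>
    obtain ⟨b, rfl⟩ := ih (by omega)
    rw [← mul_assoc, ← pow_add] at h
    rw [pow_succ]
    exact mul_dvd_mul_left _ (truncated_p_dvd p k m b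
      (residue_eq_zero_of_p_pow_mul_eq_zero (by omega) h))

theorem p_pow_sub_dvd_of_p_pow_dvd_mul {v : ℕ} {a : TruncatedWittVector p (m + 1) k}
    (h : (p : TruncatedWittVector p (m + 1) k) ^ m ∣
      (p : TruncatedWittVector p (m + 1) k) ^ v * a) :
    (p : TruncatedWittVector p (m + 1) k) ^ (m - v) ∣ a := by
  rcases le_total m v with hmv | hvm
  · rw [Nat.sub_eq_zero_of_le hmv, pow_zero]
    exact one_dvd a
  · obtain ⟨b, hb⟩ := h
    refine (dvd_sub_left (dvd_mul_right _ b)).mp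
      (p_pow_dvd_of_p_pow_mul_eq_zero (v := v) (by omega) ?_)
    rw [mul_sub, hb, ← mul_assoc, ← pow_add, Nat.add_sub_cancel' hvm, sub_self]

theorem pow_sup_dvd {M ι : Type*} [Monoid M] {x a : M} {s : Finset ι} {f : ι → ℕ}
    (h : ∀ j ∈ s, x ^ f j ∣ a) : x ^ s.sup f ∣ a := by
  refine Finset.sup_induction (p := fun i => x ^ i ∣ a) ?_ (fun i hi l hl => ?_) h
  · rw [bot_eq_zero, pow_zero]
    exact one_dvd a
  · rcases max_choice i l with hmax | hmax <;> rwa [hmax]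

theorem exists_p_pow_dvd_and_p_pow_dvd {ι : Type*} [Finite ι] {e : ι → ℕ}
    {a : TruncatedWittVector p (m + 1) k}
    (h : ∀ j, (p : TruncatedWittVector p (m + 1) k) ^ m ∣ e j * a) :
    ∃ i ≤ m, (∀ j, p ^ (m - i) ∣ e j) ∧ (p : TruncatedWittVector p (m + 1) k) ^ i ∣ a := by
  cases nonempty_fintype ι
  choose v hv hassoc using
    fun j => exists_pow_dvd_and_associated_natCast (truncated_p_pow p k (m + 1)) (e j)
  refine ⟨Finset.univ.sup fun j => m - v j, Finset.sup_le fun j _ => Nat.sub_le _ _,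
    fun j => (pow_dvd_pow p ?_).trans (hv j), ?_⟩
  · have hj : m - v j ≤ Finset.univ.sup fun j => m - v j :=
      Finset.le_sup (f := fun j => m - v j) (Finset.mem_univ j)
    omega
  · exact pow_sup_dvd fun j _ =>
      p_pow_sub_dvd_of_p_pow_dvd_mul (((hassoc j).mul_right a).dvd_iff_dvd_right.mp (h j))

theorem eq_sum_p_pow_mul_teichmuller (y : TruncatedWittVector p (m + 1) k) :
    y = ∑ i : Fin (m + 1), (p : TruncatedWittVector p (m + 1) k) ^ (i : ℕ) *
      WittVector.truncate (m + 1)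
        (WittVector.teichmuller p ((iterateFrobeniusEquiv k p i).symm (y.coeff i))) := by
  obtain ⟨x, rfl⟩ := WittVector.truncate_surjective p (m + 1) k y
  obtain ⟨c, hc⟩ := WittVector.dvd_sub_sum_teichmuller_iterateFrobeniusEquiv_coeff x m
  have h := congrArg (WittVector.truncate (m + 1)) hc
  rw [map_mul, map_pow, map_natCast, truncated_p_pow, zero_mul, map_sub, sub_eq_zero] at h
  simp only [WittVector.coeff_truncate, iterateFrobeniusEquiv_symm]
  rw [h, map_sum, ← Nat.range_succ_eq_Iic, Finset.sum_range]
  simp only [map_mul, map_pow, map_natCast, mul_comm]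

theorem sum_p_pow_mul_teichmuller_pow (c : TruncatedWittVector p (m + 1) k) :
    ∑ i : Fin (m + 1), (p : TruncatedWittVector p (m + 1) k) ^ (i : ℕ) *
        WittVector.truncate (m + 1) (WittVector.teichmuller p (c.coeff i)) ^ p ^ (m - i) =
      truncMap (m + 1) (iterateFrobenius k p m) c := by
  rw [eq_sum_p_pow_mul_teichmuller (truncMap (m + 1) (iterateFrobenius k p m) c)]
  refine Finset.sum_congr rfl fun i _ => ?_
  have hroot : (iterateFrobeniusEquiv k p i).symm (c.coeff i ^ p ^ m) =
      c.coeff i ^ p ^ (m - i) := by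
    rw [RingEquiv.symm_apply_eq, iterateFrobeniusEquiv_def, ← pow_mul, ← pow_add,
      Nat.sub_add_cancel (Nat.lt_succ_iff.mp i.2)]
  rw [coeff_truncMap, iterateFrobenius_def, hroot, map_pow, map_pow]

end TruncatedWittVectors

section Ghost

/-- The zeroth summand is recovered modulo `p`; once it vanishes, the remaining sum is divisible by
one more power of `p`. -/
theorem eq_zero_of_p_pow_mul_ghost_sum_eq_zero {S T : Type*} [CommRing S] [CommRing T] {p : ℕ}
    [Fact p.Prime] [CharP T p] [IsReduced T] {ρ : S →+* T} {N : ℕ}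
    (hρ : ∀ s < N, ∀ c : S, (p : S) ^ s * c = 0 → ρ c = 0) {n s : ℕ} (hs : s + n ≤ N)
    {g : Fin n → S} (hg : ∀ i, ρ (g i) = 0 → g i = 0)
    (h : (p : S) ^ s * ∑ i : Fin n, (p : S) ^ (i : ℕ) * g i ^ p ^ (n - 1 - (i : ℕ)) = 0)
    (i : Fin n) : g i = 0 := by
  induction n generalizing s with
  | zero => exact i.elim0
  | succ n ih =>
    have hsplit : ∑ i : Fin (n + 1), (p : S) ^ (i : ℕ) * g i ^ p ^ (n + 1 - 1 - (i : ℕ)) =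
        g 0 ^ p ^ n +
          p * ∑ i : Fin n, (p : S) ^ (i : ℕ) * g i.succ ^ p ^ (n - 1 - (i : ℕ)) := by
      simp [Fin.sum_univ_succ, Finset.mul_sum, pow_succ', mul_assoc, Nat.sub_sub, add_comm 1]
    rw [hsplit] at h
    have h0 : g 0 = 0 := hg 0 <| eq_zero_of_pow_eq_zero (n := p ^ n) <| by
      simpa using hρ s (by omega) _ h
    have hsucc : ∀ i : Fin n, g i.succ = 0 :=
      ih (s := s + 1) (by omega) (fun i => hg i.succ) <| by
        rwa [h0, zero_pow (pow_ne_zero n (Fact.out : p.Prime).ne_zero), zero_add, ← mul_assoc,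
          ← pow_succ] at h
    exact Fin.cases h0 hsucc i

section Lift

variable (p : ℕ) [Fact p.Prime] {k : Type*} [Field k]

theorem coeff_polyLift (n : ℕ) {d : ℕ} (f : MvPolynomial (Fin d) k) (e : Fin d →₀ ℕ) :
    coeff e (polyLift p k n f) =
      WittVector.truncate n (WittVector.teichmuller p (coeff e f)) := by
  simp only [polyLift, coeff_sum, coeff_monomial, Finset.sum_ite_eq']
  split_ifs with h
  · rfl
  · rw [notMem_support_iff.mp h, WittVector.teichmuller_zero, map_zero]

theorem polyLift_monomial (n : ℕ) {d : ℕ} (e : Fin d →₀ ℕ) (a : k) :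
    polyLift p k n (monomial e a) =
      monomial e (WittVector.truncate n (WittVector.teichmuller p a)) := by
  ext u
  rw [coeff_polyLift, coeff_monomial, coeff_monomial]
  split_ifs
  · rfl
  · rw [WittVector.teichmuller_zero, map_zero]

theorem polyLift_zero (n d : ℕ) : polyLift p k n (0 : MvPolynomial (Fin d) k) = 0 :=
  Finset.sum_empty

theorem map_res_polyLift (n : ℕ) {d : ℕ} (f : MvPolynomial (Fin d) k) :
    map (res n) (polyLift p k (n + 1) f) = polyLift p k n f := by
  ext e
  rw [coeff_map, coeff_polyLift, coeff_polyLift, res,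
    TruncatedWittVector.truncate_wittVector_truncate]

theorem map_residue_polyLift (m : ℕ) {d : ℕ} (f : MvPolynomial (Fin d) k) :
    map (residue p m k) (polyLift p k (m + 1) f) = f := by
  ext e
  rw [coeff_map, coeff_polyLift, residue_apply, WittVector.coeff_truncate]
  exact WittVector.teichmuller_coeff_zero p _

variable {p} in
theorem map_residue_eq_zero_of_p_pow_mul_eq_zero [CharP k p] {m s d : ℕ} (hs : s ≤ m)
    {g : MvPolynomial (Fin d) (TruncatedWittVector p (m + 1) k)}
    (h : (p : MvPolynomial (Fin d) (TruncatedWittVector p (m + 1) k)) ^ s * g = 0) :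
    map (residue p m k) g = 0 := by
  ext e
  rw [coeff_map, coeff_zero]
  refine residue_eq_zero_of_p_pow_mul_eq_zero hs ?_
  rw [← coeff_C_mul, map_pow, map_natCast, h, coeff_zero]

variable (k)

theorem map_residue_surjective (m d : ℕ) :
    Function.Surjective (map (σ := Fin d) (residue p m k)) := fun f =>
  ⟨polyLift p k (m + 1) f, map_residue_polyLift p m f⟩

theorem truncate_map_residue_surjective (m d : ℕ) :
    Function.Surjective
      fun G : WittVector p (MvPolynomial (Fin d) (TruncatedWittVector p (m + 1) k)) =>
        WittVector.truncate (m + 1) (WittVector.map (map (residue p m k)) G) :=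
  (WittVector.truncate_surjective p (m + 1) _).comp
    (WittVector.map_surjective _ (map_residue_surjective p k m d))

end Lift

variable (p : ℕ) [Fact p.Prime] (k : Type*) [Field k] [CharP k p] [PerfectRing k p]

variable {p k} in
theorem ghostTilde_eq_of_map_residue {m d : ℕ}
    {x : TruncatedWittVector p (m + 1) (MvPolynomial (Fin d) k)}
    {g : Fin (m + 1) → MvPolynomial (Fin d) (TruncatedWittVector p (m + 1) k)}
    (hg : ∀ i, map (residue p m k) (g i) = x.coeff i) :
    ghostTilde p k (m + 1) x =
      ∑ i : Fin (m + 1), (p : MvPolynomial (Fin d) (TruncatedWittVector p (m + 1) k)) ^ (i : ℕ) *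
        g i ^ p ^ (m - (i : ℕ)) :=
  ghostTilde_eq p k m x g fun i e => by rw [← hg i, coeff_map, residue_apply]

variable {p k} in
theorem ghostTilde_truncate_map {m d : ℕ}
    (G : WittVector p (MvPolynomial (Fin d) (TruncatedWittVector p (m + 1) k))) :
    ghostTilde p k (m + 1)
        (WittVector.truncate (m + 1) (WittVector.map (map (residue p m k)) G)) =
      WittVector.ghostComponent m G := by
  rw [ghostTilde_eq_of_map_residue (g := fun i => G.coeff i) fun i => by
    rw [WittVector.coeff_truncate, WittVector.map_coeff], WittVector.ghostComponent_apply,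
    aeval_wittPolynomial, Finset.sum_range]

/-- `ghostTilde` as a ring homomorphism `W_n(A) → A_n`, for `n = m + 1`. The ring
homomorphism laws hold because it factors the top ghost component of `W(A_n)`. -/
noncomputable def ghostHom (m d : ℕ) :
    TruncatedWittVector p (m + 1) (MvPolynomial (Fin d) k) →+*
      MvPolynomial (Fin d) (TruncatedWittVector p (m + 1) k) where
  toFun := ghostTilde p k (m + 1)
  map_one' := by simpa only [map_one] using ghostTilde_truncate_map (p := p) (k := k) (d := d) 1
  map_zero' := by simpa only [map_zero] using ghostTilde_truncate_map (p := p) (k := k) (d := d) 0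
  map_mul' x y := by
    obtain ⟨G, rfl⟩ := truncate_map_residue_surjective p k m d x
    obtain ⟨H, rfl⟩ := truncate_map_residue_surjective p k m d y
    simp only [← map_mul, ghostTilde_truncate_map]
  map_add' x y := by
    obtain ⟨G, rfl⟩ := truncate_map_residue_surjective p k m d x
    obtain ⟨H, rfl⟩ := truncate_map_residue_surjective p k m d y
    simp only [← map_add, ghostTilde_truncate_map]

theorem ghostHom_apply {m d : ℕ} (x : TruncatedWittVector p (m + 1) (MvPolynomial (Fin d) k)) :
    ghostHom p k m d x = ghostTilde p k (m + 1) x :=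
  rfl

theorem ghostHom_injective (m d : ℕ) : Function.Injective (ghostHom p k m d) := by
  refine (injective_iff_map_eq_zero _).mpr fun x hx => TruncatedWittVector.ext fun i => ?_
  have hlift : polyLift p k (m + 1) (x.coeff i) = 0 :=
    eq_zero_of_p_pow_mul_ghost_sum_eq_zero (ρ := map (residue p m k)) (N := m + 1) (s := 0)
      (g := fun i => polyLift p k (m + 1) (x.coeff i))
      (fun s hs _ => map_residue_eq_zero_of_p_pow_mul_eq_zero (Nat.lt_succ_iff.mp hs)) (by simp)
      (fun i hi => by rw [← map_residue_polyLift p m (x.coeff i), hi, polyLift_zero])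
      (by rw [pow_zero, one_mul]; exact hx) i
  rw [TruncatedWittVector.coeff_zero, ← map_residue_polyLift p m (x.coeff i), hlift, map_zero]

theorem ghostTilde_injective (n d : ℕ) :
    Function.Injective (ghostTilde (d := d) p k n) := by
  cases n with
  | zero =>
    have := subsingleton_truncatedWittVector_zero p (MvPolynomial (Fin d) k)
    exact Function.injective_of_subsingleton _
  | succ m => exact ghostHom_injective p k m d

end Ghost

section Image

variable (p : ℕ) [Fact p.Prime] {k : Type*} [Field k]

theorem dvdDifferential_ghostTilde {n d : ℕ}
    (x : TruncatedWittVector p n (MvPolynomial (Fin d) k)) :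
    DvdDifferential ((p : TruncatedWittVector p n k) ^ (n - 1)) (ghostTilde p k n x) := by
  intro j
  rw [ghostTilde, map_sum]
  refine Finset.dvd_sum fun i _ => ?_
  have hp : (p : MvPolynomial (Fin d) (TruncatedWittVector p n k)) ^ (i : ℕ) =
      C ((p : TruncatedWittVector p n k) ^ (i : ℕ)) := by
    rw [map_pow, map_natCast]
  have hsplit : (C ((p : TruncatedWittVector p n k) ^ (n - 1)) : MvPolynomial (Fin d) _) =
      C ((p : TruncatedWittVector p n k) ^ (i : ℕ)) *
        C ((p ^ (n - 1 - (i : ℕ)) : ℕ) : TruncatedWittVector p n k) := by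
    rw [Nat.cast_pow, ← map_mul, ← pow_add, Nat.add_sub_cancel' (by omega)]
  rw [hp, hsplit, map_natCast C, pderiv_C_mul, Derivation.leibniz_pow, nsmul_eq_mul]
  exact mul_dvd_mul_left _ (dvd_mul_right _ _)

theorem ghostTilde_single {m d : ℕ} (i : Fin (m + 1)) (f : MvPolynomial (Fin d) k) :
    ghostTilde p k (m + 1) (TruncatedWittVector.mk p (Pi.single i f)) =
      (p : MvPolynomial (Fin d) (TruncatedWittVector p (m + 1) k)) ^ (i : ℕ) *
        polyLift p k (m + 1) f ^ p ^ (m - (i : ℕ)) := by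
  rw [ghostTilde, Finset.sum_eq_single i]
  · rw [TruncatedWittVector.coeff_mk, Pi.single_eq_same, Nat.add_sub_cancel]
  · intro l _ hl
    rw [TruncatedWittVector.coeff_mk, Pi.single_eq_of_ne hl, polyLift_zero,
      zero_pow (pow_ne_zero _ (Fact.out : p.Prime).ne_zero), mul_zero]
  · exact fun hi => absurd (Finset.mem_univ i) hi

variable {p} [CharP k p] [PerfectRing k p]

theorem ghostTilde_truncMap_C {m d : ℕ} (c : TruncatedWittVector p (m + 1) k) :
    ghostTilde p k (m + 1) (truncMap (m + 1) (C (σ := Fin d)) c) =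
      C (truncMap (m + 1) (iterateFrobenius k p m) c) := by
  have hlift : ∀ a : k, polyLift p k (m + 1) (C (σ := Fin d) a) =
      C (WittVector.truncate (m + 1) (WittVector.teichmuller p a)) :=
    polyLift_monomial p (m + 1) 0
  simp only [ghostTilde, coeff_truncMap, hlift, ← sum_p_pow_mul_teichmuller_pow, map_sum, map_mul,
    map_pow, map_natCast, Nat.add_sub_cancel]

theorem C_mem_range_ghostHom {m d : ℕ} (b : TruncatedWittVector p (m + 1) k) :
    C b ∈ (ghostHom p k m d).range := by
  obtain ⟨c, rfl⟩ := truncMap_surjective (m + 1)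
    (f := iterateFrobenius k p m) (iterateFrobeniusEquiv k p m).surjective b
  exact ⟨_, ghostTilde_truncMap_C c⟩

theorem monomial_mem_range_ghostHom {m d i : ℕ} (hi : i ≤ m) {e : Fin d →₀ ℕ}
    {a : TruncatedWittVector p (m + 1) k} (he : ∀ j, p ^ (m - i) ∣ e j)
    (ha : (p : TruncatedWittVector p (m + 1) k) ^ i ∣ a) :
    monomial e a ∈ (ghostHom p k m d).range := by
  obtain ⟨b, rfl⟩ := ha
  choose u hu using he
  obtain rfl : e = p ^ (m - i) • Finsupp.equivFunOnFinite.symm u := Finsupp.ext hu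
  have hsingle := ghostTilde_single p (⟨i, Nat.lt_succ_iff.mpr hi⟩ : Fin (m + 1))
    (monomial (Finsupp.equivFunOnFinite.symm u) (1 : k))
  rw [polyLift_monomial, map_one (WittVector.teichmuller p),
    map_one (WittVector.truncate (m + 1)), monomial_pow, one_pow, ← map_natCast C, ← map_pow,
    C_mul_monomial, mul_one] at hsingle
  rw [mul_comm, ← C_mul_monomial, ← hsingle]
  exact mul_mem (C_mem_range_ghostHom b) ⟨_, rfl⟩

theorem mem_range_ghostHom_iff {m d : ℕ}
    {g : MvPolynomial (Fin d) (TruncatedWittVector p (m + 1) k)} :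
    g ∈ (ghostHom p k m d).range ↔
      DvdDifferential ((p : TruncatedWittVector p (m + 1) k) ^ m) g := by
  refine ⟨fun ⟨x, hx⟩ => hx ▸ dvdDifferential_ghostTilde p x, fun hg => ?_⟩
  rw [g.as_sum]
  refine sum_mem fun e _ => ?_
  obtain ⟨i, hi, he, ha⟩ :=
    exists_p_pow_dvd_and_p_pow_dvd fun j => hg.dvd_natCast_mul_coeff j e
  exact monomial_mem_range_ghostHom hi he ha

end Image

section Operators

variable {p : ℕ} [Fact p.Prime] {k : Type*} [Field k]

theorem isRestriction_restriction {n d : ℕ}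
    {D : Module.End (TruncatedWittVector p n k)
      (MvPolynomial (Fin d) (TruncatedWittVector p n k))}
    {δ : Module.End (TruncatedWittVector p n k)
      (TruncatedWittVector p n (MvPolynomial (Fin d) k))} (hδ : IsRestriction p k D δ) :
    IsRestriction p k D (restriction p k D) := by
  have hex : ∃ δ, IsRestriction p k D δ := ⟨δ, hδ⟩
  rw [restriction, dif_pos hex]
  exact hex.choose_spec

variable [CharP k p] [PerfectRing k p]

theorem IsRestriction.eq {n d : ℕ}
    {D : Module.End (TruncatedWittVector p n k)
      (MvPolynomial (Fin d) (TruncatedWittVector p n k))}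
    {δ ε : Module.End (TruncatedWittVector p n k)
      (TruncatedWittVector p n (MvPolynomial (Fin d) k))}
    (hδ : IsRestriction p k D δ) (hε : IsRestriction p k D ε) : δ = ε :=
  LinearMap.ext fun x => ghostTilde_injective p k n d <| by rw [hδ.2, hε.2]

theorem exists_isDiffOp_ghostTilde_comm {n d r : ℕ}
    {D : Module.End (TruncatedWittVector p n k)
      (MvPolynomial (Fin d) (TruncatedWittVector p n k))} (hDr : IsDiffOp r D)
    (hD : ∀ g, DvdDifferential ((p : TruncatedWittVector p n k) ^ (n - 1)) g →
      DvdDifferential ((p : TruncatedWittVector p n k) ^ (n - 1)) (D g)) :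
    ∃ δ : Module.End (TruncatedWittVector p n k)
      (TruncatedWittVector p n (MvPolynomial (Fin d) k)),
      IsDiffOp r δ ∧ ∀ x, ghostTilde p k n (δ x) = D (ghostTilde p k n x) := by
  cases n with
  | zero =>
    have := subsingleton_truncatedWittVector_zero p k
    have : Subsingleton (MvPolynomial (Fin d) (TruncatedWittVector p 0 k)) :=
      Module.subsingleton (TruncatedWittVector p 0 k) _
    exact ⟨0, IsDiffOp.zero r, fun _ => Subsingleton.elim _ _⟩
  | succ m =>
    obtain ⟨δ, hδ⟩ := exists_intertwining_of_injective (ghostHom_injective p k m d)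
      (fun c => ⟨_, ghostTilde_truncMap_C c⟩)
      fun x => mem_range_ghostHom_iff.mpr (hD _ (dvdDifferential_ghostTilde p x))
    exact ⟨δ, hDr.of_injective (ghostHom_injective p k m d) hδ, hδ⟩

theorem isRestriction_and_isDiffOp_wittDiffOp {n d : ℕ} (j : Fin d) (r : ℕ) :
    IsRestriction p k (hasse (TruncatedWittVector p n k) j r) (wittDiffOp p k n j r) ∧
      IsDiffOp r (wittDiffOp p k n j r) := by
  obtain ⟨δ, hδr, hδ⟩ := exists_isDiffOp_ghostTilde_comm (p := p) (k := k) (n := n)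
    (isDiffOp_hasse j r) fun g hg => hg.hasse j r
  have hδres : IsRestriction p k (hasse (TruncatedWittVector p n k) j r) δ := ⟨⟨r, hδr⟩, hδ⟩
  have hres := isRestriction_restriction hδres
  exact ⟨hres, (hδres.eq hres : δ = wittDiffOp p k n j r) ▸ hδr⟩

theorem ghostTilde_wittDiffOp {n d : ℕ} (j : Fin d) (r : ℕ)
    (x : TruncatedWittVector p n (MvPolynomial (Fin d) k)) :
    ghostTilde p k n (wittDiffOp p k n j r x) =
      hasse (TruncatedWittVector p n k) j r (ghostTilde p k n x) :=
  (isRestriction_and_isDiffOp_wittDiffOp j r).1.2 x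

end Operators

section Frobenius

variable {p : ℕ} [Fact p.Prime] {k : Type*} [Field k] [CharP k p] {m d : ℕ}

theorem map_residue_frobLift (g : MvPolynomial (Fin d) (TruncatedWittVector p (m + 1) k)) :
    map (residue p m k) (frobLift p (truncMap (m + 1) (frobenius k p)) g) =
      map (residue p m k) g ^ p := by
  have h : (map (residue p m k)).comp (frobLift p (truncMap (m + 1) (frobenius k p))) =
      (frobenius (MvPolynomial (Fin d) k) p).comp (map (residue p m k)) := by
    refine ringHom_ext (fun c => ?_) fun j => ?_
    · simp [frobLift_C, residue_apply, coeff_truncMap, frobenius_def]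
    · simp [frobLift_X, frobenius_def]
  exact congrArg (fun f => f g) h

variable [PerfectRing k p]

theorem ghostTilde_frobA (x : TruncatedWittVector p (m + 1) (MvPolynomial (Fin d) k)) :
    ghostTilde p k (m + 1) (frobA p k (m + 1) d x) =
      frobLift p (truncMap (m + 1) (frobenius k p)) (ghostTilde p k (m + 1) x) := by
  have hlift : ∀ i, map (residue p m k)
      (frobLift p (truncMap (m + 1) (frobenius k p)) (polyLift p k (m + 1) (x.coeff i))) =
        (frobA p k (m + 1) d x).coeff i := fun i => by
    rw [map_residue_frobLift, map_residue_polyLift, frobA, coeff_truncMap, frobenius_def]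
  rw [ghostTilde_eq_of_map_residue hlift]
  simp [ghostTilde]

theorem frobLift_ghostTilde_res
    (x : TruncatedWittVector p (m + 1 + 1) (MvPolynomial (Fin d) k)) :
    frobLift p (truncMap (m + 1) (frobenius k p)) (ghostTilde p k (m + 1) (res (m + 1) x)) =
      map (res (m + 1)) (ghostTilde p k (m + 1 + 1) x) := by
  have hlift : ∀ i, map (residue p m k) (polyLift p k (m + 1) (x.coeff i.castSucc) ^ p) =
      (frobA p k (m + 1) d (res (m + 1) x)).coeff i := fun i => by
    have hcoeff : (res (m + 1) x).coeff i = x.coeff i.castSucc :=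
      TruncatedWittVector.coeff_truncate (Nat.le_succ (m + 1)) i x
    rw [map_pow, map_residue_polyLift, frobA, coeff_truncMap, frobenius_def, hcoeff]
  have hp : (p : MvPolynomial (Fin d) (TruncatedWittVector p (m + 1) k)) ^ (m + 1) = 0 := by
    rw [← map_natCast C, ← map_pow, truncated_p_pow, map_zero]
  rw [← ghostTilde_frobA, ghostTilde_eq_of_map_residue hlift, ghostTilde,
    Fin.sum_univ_castSucc (n := m + 1), map_add, map_sum]
  simp only [map_mul, map_pow, map_natCast, map_res_polyLift, Fin.val_last, hp, zero_mul,
    add_zero, Fin.val_castSucc]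
  refine Finset.sum_congr rfl fun i _ => ?_
  rw [← pow_mul, ← pow_succ', Nat.add_sub_cancel, Nat.sub_add_comm (Nat.lt_succ_iff.mp i.2)]

theorem frobLift_ghostTilde_wittDiffOpDiv (j : Fin d) (r : ℕ)
    (x : TruncatedWittVector p (m + 1) (MvPolynomial (Fin d) k)) :
    frobLift p (truncMap (m + 1) (frobenius k p))
        (ghostTilde p k (m + 1) (wittDiffOpDiv p k (m + 1) j r x)) =
      hasse (TruncatedWittVector p (m + 1) k) j r
        (frobLift p (truncMap (m + 1) (frobenius k p)) (ghostTilde p k (m + 1) x)) := by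
  have hkill : C (p : TruncatedWittVector p (m + 1) k) * pderiv j (ghostTilde p k (m + 1) x) =
      0 := by
    obtain ⟨h, hh⟩ := dvdDifferential_ghostTilde p x j
    rw [hh, Nat.add_sub_cancel, ← mul_assoc, ← map_mul, ← pow_succ', truncated_p_pow, map_zero,
      zero_mul]
  rw [hasse_frobLift (truncated_p_pow p k (m + 1)) _ hkill, wittDiffOpDiv]
  split_ifs
  · rw [ghostTilde_wittDiffOp]
  · rw [LinearMap.zero_apply, ← ghostHom_apply, map_zero, map_zero]

theorem wittDiffOpDiv_res {n : ℕ} (j : Fin d) (r : ℕ)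
    (x : TruncatedWittVector p (n + 1) (MvPolynomial (Fin d) k)) :
    wittDiffOpDiv p k n j r (res n x) = res n (wittDiffOp p k (n + 1) j r x) := by
  cases n with
  | zero =>
    have := subsingleton_truncatedWittVector_zero p (MvPolynomial (Fin d) k)
    exact Subsingleton.elim _ _
  | succ m =>
    have hinj := frobLift_injective (σ := Fin d) (Fact.out : p.Prime).pos
      (truncMap_injective (p := p) (m + 1) (frobenius_inj k p))
    apply ghostTilde_injective p k (m + 1) d
    apply hinj
    rw [frobLift_ghostTilde_wittDiffOpDiv, frobLift_ghostTilde_res, frobLift_ghostTilde_res,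
      ghostTilde_wittDiffOp, map_hasse]

theorem wittDiffOp_frobA (j : Fin d) (r : ℕ)
    (x : TruncatedWittVector p (m + 1) (MvPolynomial (Fin d) k)) :
    wittDiffOp p k (m + 1) j r (frobA p k (m + 1) d x) =
      frobA p k (m + 1) d (wittDiffOpDiv p k (m + 1) j r x) := by
  apply ghostTilde_injective p k (m + 1) d
  rw [ghostTilde_wittDiffOp, ghostTilde_frobA, ghostTilde_frobA,
    frobLift_ghostTilde_wittDiffOpDiv]

end Frobenius

section Verschiebung

variable {p : ℕ} [Fact p.Prime] {k : Type*} [Field k] [CharP k p] {n d : ℕ}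

theorem C_p_mul_eq_of_map_res_eq {y z : MvPolynomial (Fin d) (TruncatedWittVector p (n + 1) k)}
    (h : map (res n) y = map (res n) z) :
    C (p : TruncatedWittVector p (n + 1) k) * y =
      C (p : TruncatedWittVector p (n + 1) k) * z := by
  rw [← sub_eq_zero, ← mul_sub]
  ext1 e
  rw [coeff_C_mul, coeff_zero]
  apply p_mul_eq_zero_of_res_eq_zero
  rw [← coeff_map, map_sub, h, sub_self, coeff_zero]

theorem ghostTilde_ver {x : TruncatedWittVector p n (MvPolynomial (Fin d) k)}
    {y : MvPolynomial (Fin d) (TruncatedWittVector p (n + 1) k)}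
    (hy : map (res n) y = ghostTilde p k n x) :
    ghostTilde p k (n + 1) (ver n x) = C (p : TruncatedWittVector p (n + 1) k) * y := by
  have hlift : map (res n)
      (∑ i : Fin n, (p : MvPolynomial (Fin d) (TruncatedWittVector p (n + 1) k)) ^ (i : ℕ) *
        polyLift p k (n + 1) (x.coeff i) ^ p ^ (n - 1 - (i : ℕ))) = ghostTilde p k n x := by
    simp only [map_sum, map_mul, map_pow, map_natCast, map_res_polyLift, ghostTilde]
  rw [C_p_mul_eq_of_map_res_eq (hy.trans hlift.symm), ghostTilde, Fin.sum_univ_succ, ver,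
    TruncatedWittVector.coeff_mk, Fin.cons_zero, polyLift_zero,
    zero_pow (pow_ne_zero _ (Fact.out : p.Prime).ne_zero), mul_zero, zero_add, Finset.mul_sum]
  refine Finset.sum_congr rfl fun i _ => ?_
  rw [TruncatedWittVector.coeff_mk, Fin.cons_succ, Fin.val_succ, pow_succ', mul_assoc,
    map_natCast, Nat.add_sub_cancel, Nat.sub_sub, add_comm 1]

variable [PerfectRing k p]

theorem wittDiffOp_ver (j : Fin d) (r : ℕ)
    (x : TruncatedWittVector p n (MvPolynomial (Fin d) k)) :
    wittDiffOp p k (n + 1) j r (ver n x) = ver n (wittDiffOp p k n j r x) := by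
  obtain ⟨y, hy⟩ := map_surjective (res n)
    (TruncatedWittVector.truncate_surjective (Nat.le_succ n)) (ghostTilde p k n x)
  have hδy : map (res n) (hasse (TruncatedWittVector p (n + 1) k) j r y) =
      ghostTilde p k n (wittDiffOp p k n j r x) := by
    rw [map_hasse, hy, ghostTilde_wittDiffOp]
  apply ghostTilde_injective p k (n + 1) d
  rw [ghostTilde_wittDiffOp, ghostTilde_ver hy, ghostTilde_ver hδy, ← smul_eq_C_mul, map_smul,
    smul_eq_C_mul]

theorem wittDiffOp_iterate_ver_res (j : Fin d) (r i : ℕ)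
    (x : TruncatedWittVector p (n + 1) (MvPolynomial (Fin d) k)) :
    wittDiffOp p k (n + 1) j r ((fun y => ver n (res n y))^[i] x) =
      (fun y => ver n (res n y))^[i] (wittDiffOp p k (n + 1) j (p ^ i * r) x) := by
  induction i generalizing r with
  | zero => rw [pow_zero, one_mul, Function.iterate_zero_apply, Function.iterate_zero_apply]
  | succ i ih =>
    rw [Function.iterate_succ_apply', Function.iterate_succ_apply', pow_succ, mul_assoc, ← ih,
      wittDiffOp_ver, ← wittDiffOpDiv_res, wittDiffOpDiv, if_pos (dvd_mul_right p r),
      Nat.mul_div_cancel_left r (Fact.out : p.Prime).pos]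

theorem wittDiffOp_mem_verFil (j : Fin d) (r : ℕ) {i : ℕ}
    {x : TruncatedWittVector p (n + 1) (MvPolynomial (Fin d) k)}
    (hx : x ∈ verFil p n i (MvPolynomial (Fin d) k)) :
    wittDiffOp p k (n + 1) j r x ∈ verFil p n i (MvPolynomial (Fin d) k) := by
  obtain ⟨y, rfl⟩ := hx
  exact ⟨_, (wittDiffOp_iterate_ver_res j r i y).symm⟩

end Verschiebung

section MultiIndex

theorem prod_ofFn_apply_eq_of_intertwines {R S M N : Type*} [Semiring R] [Semiring S]
    [AddCommMonoid M] [Module R M] [AddCommMonoid N] [Module S N] {d : ℕ}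
    {a : Fin d → Module.End R M} {b : Fin d → Module.End S N} {f : N → M}
    (h : ∀ j x, a j (f x) = f (b j x)) (x : N) :
    (List.ofFn a).prod (f x) = f ((List.ofFn b).prod x) := by
  simp only [List.ofFn_eq_map]
  exact List.prod_hom_rel _
    (r := fun (u : Module.End R M) (v : Module.End S N) => ∀ x, u (f x) = f (v x)) (fun _ => rfl)
    (fun j u v huv x => by rw [Module.End.mul_apply, huv, h, Module.End.mul_apply]) x

variable {p : ℕ} [Fact p.Prime] {k : Type*} [Field k] [CharP k p] [PerfectRing k p] {n d : ℕ}

theorem wittDiffOpMultiDiv_res (r : Fin d → ℕ)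
    (x : TruncatedWittVector p (n + 1) (MvPolynomial (Fin d) k)) :
    wittDiffOpMultiDiv p k n r (res n x) = res n (wittDiffOpMulti p k (n + 1) r x) :=
  prod_ofFn_apply_eq_of_intertwines (fun j => wittDiffOpDiv_res j (r j)) x

theorem wittDiffOpMulti_frobA (r : Fin d → ℕ)
    (x : TruncatedWittVector p (n + 1) (MvPolynomial (Fin d) k)) :
    wittDiffOpMulti p k (n + 1) r (frobA p k (n + 1) d x) =
      frobA p k (n + 1) d (wittDiffOpMultiDiv p k (n + 1) r x) :=
  prod_ofFn_apply_eq_of_intertwines (fun j => wittDiffOp_frobA j (r j)) x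

theorem wittDiffOpMulti_ver (r : Fin d → ℕ)
    (x : TruncatedWittVector p n (MvPolynomial (Fin d) k)) :
    wittDiffOpMulti p k (n + 1) r (ver n x) = ver n (wittDiffOpMulti p k n r x) :=
  prod_ofFn_apply_eq_of_intertwines (fun j => wittDiffOp_ver j (r j)) x

theorem wittDiffOpMulti_mem_verFil (r : Fin d → ℕ) {i : ℕ}
    {x : TruncatedWittVector p (n + 1) (MvPolynomial (Fin d) k)}
    (hx : x ∈ verFil p n i (MvPolynomial (Fin d) k)) :
    wittDiffOpMulti p k (n + 1) r x ∈ verFil p n i (MvPolynomial (Fin d) k) := by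
  refine List.prod_induction
    (fun u : Module.End _ _ => ∀ y ∈ verFil p n i (MvPolynomial (Fin d) k),
      u y ∈ verFil p n i (MvPolynomial (Fin d) k))
    (fun u v hu hv y hy => hu _ (hv y hy)) (fun _ hy => hy) (fun u hu y hy => ?_) x hx
  obtain ⟨j, rfl⟩ := List.mem_ofFn.mp hu
  exact wittDiffOp_mem_verFil j (r j) hy

end MultiIndex

end WittDiff

theorem mainTheorem4 (p : ℕ) [Fact p.Prime] (k : Type*) [Field k] [CharP k p] [PerfectRing k p]
    (d : ℕ) :
    -- `∂_{j,n}^{[r]}` is well defined on `W_n(A)`: it is the unique restriction, and has order `≤ r`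
    (∀ (n : ℕ) (j : Fin d) (r : ℕ),
      WittDiff.IsRestriction p k (WittDiff.hasse (TruncatedWittVector p n k) j r)
        (WittDiff.wittDiffOp p k n j r) ∧
      WittDiff.IsDiffOp r (WittDiff.wittDiffOp p k n j r) ∧
      ∀ δ, WittDiff.IsRestriction p k (WittDiff.hasse (TruncatedWittVector p n k) j r) δ →
        δ = WittDiff.wittDiffOp p k n j r) ∧
    -- the four relations for a single variable
    (∀ (n : ℕ) (j : Fin d) (r : ℕ),
      (∀ x, WittDiff.wittDiffOpDiv p k n j r (WittDiff.res n x) =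
        WittDiff.res n (WittDiff.wittDiffOp p k (n + 1) j r x)) ∧
      (∀ x, WittDiff.wittDiffOp p k (n + 1) j r (WittDiff.frobA p k (n + 1) d x) =
        WittDiff.frobA p k (n + 1) d (WittDiff.wittDiffOpDiv p k (n + 1) j r x)) ∧
      (∀ x, WittDiff.wittDiffOp p k (n + 1) j r (WittDiff.ver n x) =
        WittDiff.ver n (WittDiff.wittDiffOp p k n j r x)) ∧
      (∀ i < n + 1, ∀ x ∈ WittDiff.verFil p n i (MvPolynomial (Fin d) k),
        WittDiff.wittDiffOp p k (n + 1) j r x ∈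
          WittDiff.verFil p n i (MvPolynomial (Fin d) k))) ∧
    -- the four relations for multi-indices
    (∀ (n : ℕ) (r : Fin d → ℕ),
      (∀ x, WittDiff.wittDiffOpMultiDiv p k n r (WittDiff.res n x) =
        WittDiff.res n (WittDiff.wittDiffOpMulti p k (n + 1) r x)) ∧
      (∀ x, WittDiff.wittDiffOpMulti p k (n + 1) r (WittDiff.frobA p k (n + 1) d x) =
        WittDiff.frobA p k (n + 1) d (WittDiff.wittDiffOpMultiDiv p k (n + 1) r x)) ∧
      (∀ x, WittDiff.wittDiffOpMulti p k (n + 1) r (WittDiff.ver n x) =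
        WittDiff.ver n (WittDiff.wittDiffOpMulti p k n r x)) ∧
      (∀ i < n + 1, ∀ x ∈ WittDiff.verFil p n i (MvPolynomial (Fin d) k),
        WittDiff.wittDiffOpMulti p k (n + 1) r x ∈
          WittDiff.verFil p n i (MvPolynomial (Fin d) k))) := by
  refine ⟨fun n j r => ?_, fun n j r => ?_, fun n r => ?_⟩
  · obtain ⟨hres, hord⟩ :=
      WittDiff.isRestriction_and_isDiffOp_wittDiffOp (p := p) (k := k) (n := n) j r
    exact ⟨hres, hord, fun δ hδ => hδ.eq hres⟩
  · exact ⟨WittDiff.wittDiffOpDiv_res j r, WittDiff.wittDiffOp_frobA j r,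
      WittDiff.wittDiffOp_ver j r, fun _ _ _ hx => WittDiff.wittDiffOp_mem_verFil j r hx⟩
  · exact ⟨WittDiff.wittDiffOpMultiDiv_res r, WittDiff.wittDiffOpMulti_frobA r,
      WittDiff.wittDiffOpMulti_ver r, fun _ _ _ hx => WittDiff.wittDiffOpMulti_mem_verFil r hx⟩
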